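/- Let $A$ denote the Glaisher–Kinkelin constant, that is $$A=\lim_{n\to\infty}\frac{\prod_{k=1}^{n}k^{k}}{n^{n^2/2+n/2+1/12}\,e^{-n^2/4}},$$ a limit which exists and is positive. Let $\log$ denote the principal branch of the logarithm, with imaginary part in $(-\pi,\pi]$; in particular $\log(\log(x^2))=\log|\log(x^2)|+i\pi$ for $0<x<1$. Then the function $$x\longmapsto \frac{x\,\log(x)\,\log(\log(x^2))}{x^4-1}$$ (defined for $x>0$, $x\neq 1$) is Lebesgue integrable on $(0,\infty)$, and $$\int_{0}^{\infty}\frac{x\,\log(x)\,\log\!\left(\log(x^2)\right)}{x^4-1}\,dx=\frac{\pi^2}{32}\left(8\log\!\left(\frac{\sqrt[3]{2}\,\sqrt[4]{\pi}}{A^3}\right)+2+i\pi\right).$$ -/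

import Mathlib

open Filter Topology MeasureTheory Set

/-- The sequence `(1¹ 2² ⋯ nⁿ) / (n ^ (n² / 2 + n / 2 + 1 / 12) * e ^ (-n² / 4))`, whose limit is
the Glaisher–Kinkelin constant. -/
noncomputable def glaisherSeq (n : ℕ) : ℝ :=
  (∏ k ∈ Finset.Icc 1 n, (k : ℝ) ^ k) /
    ((n : ℝ) ^ ((n : ℝ) ^ 2 / 2 + (n : ℝ) / 2 + 1 / 12) * Real.exp (-(n : ℝ) ^ 2 / 4))

/-- The Glaisher–Kinkelin constant `A = 1.28242712…`. -/
noncomputable def glaisherKinkelin : ℝ := limUnder atTop glaisherSeq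

/-- The integrand `x log x · log (log x²) / (x⁴ - 1)` for real `x > 0`. The outer logarithm is the
principal complex one (argument in `(-π, π]`), so `log (log x²) = log |log x²| + iπ` for
`0 < x < 1`. -/
noncomputable def nestedLogIntegrand (x : ℝ) : ℂ :=
  (x : ℂ) * (Real.log x : ℂ) * Complex.log (Real.log (x ^ 2) : ℂ) / ((x : ℂ) ^ 4 - 1)

/-! The substitution `x = exp (t / 2)` turns the integral into that of `t log t / (8 sinh t)` over
the real line. As `t / sinh t` is even, folding `t < 0` (that is, `0 < x < 1`) onto `t > 0` doubles
the real integral and adds `iπ` times the integral of `t / (8 sinh t)`. Both are read off the Mellin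
transform `2 Γ(s) (1 - 2^(-s)) ζ(s)` of `1 / sinh`: its value and its derivative at `s = 2`
(`mellin_inv_sinh`). The derivative brings in `γ` and `ζ'(2)`. The differentiated functional
equation trades the combination `1 - γ + 6 ζ'(2) / π²` for `ζ'(-1)`, and Kinkelin's formula
`deriv_riemannZeta_neg_one` introduces `A`. That formula comes from Euler–Maclaurin approximations
of `(s - 1) ζ(s)`, whose derivatives at `-1` are affine in `log (glaisherSeq (n + 1))`; their
convergence also gives the existence of the limit `A`. -/

/-! ### Euler–Maclaurin approximation of `(s - 1) ζ(s)` -/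

theorem hasDerivAt_add_ofReal_cpow {x t : ℝ} (h : 0 < x + t) (r : ℂ) :
    HasDerivAt (fun t : ℝ => ((x : ℂ) + t) ^ r) (r * ((x : ℂ) + t) ^ (r - 1)) t := by
  have h1 : HasDerivAt (fun z : ℂ => ((x : ℂ) + z) ^ r) (r * ((x : ℂ) + t) ^ (r - 1) * 1) (t : ℂ) := by
    refine HasDerivAt.cpow_const ((hasDerivAt_id _).const_add _) (Or.inl ?_)
    simpa using h
  simpa using h1.comp_ofReal

/-- Third-order Euler–Maclaurin estimate for `t ↦ t ^ (-s)` on a unit interval, multiplied by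
`s - 1` so that `s = 1` needs no special treatment. -/
theorem norm_eulerMaclaurin_cpow_le {x : ℝ} (hx : 0 < x) {s : ℂ} (hs : -3 ≤ s.re) :
    ‖((s - 1) * (((x : ℂ) + 1) ^ (-s) / 2 + s / 12 * ((x : ℂ) + 1) ^ (-s - 1))
        + ((x : ℂ) + 1) ^ (1 - s))
      - ((s - 1) * (-((x : ℂ) ^ (-s) / 2) + s / 12 * (x : ℂ) ^ (-s - 1)) + (x : ℂ) ^ (1 - s))‖
      ≤ ‖s - 1‖ * (‖s‖ * ‖s + 1‖ * ‖s + 2‖) * x ^ (-s.re - 3) := by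
  -- The coefficients are the Bernoulli polynomials `B₁`, `B₂ / 2`, `B₃ / 6`. Since `Bₖ' = k Bₖ₋₁`,
  -- the derivative telescopes to its `B₃` term, the last summand cancelling the leftover `(s - 1)
  -- (x + t)^(-s)`. `B₃` vanishes at both endpoints.
  let Φ : ℝ → ℂ := fun t =>
    (s - 1) * (((t : ℂ) - 1 / 2) * ((x : ℂ) + t) ^ (-s)
      + ((t : ℂ) ^ 2 - t + 1 / 6) / 2 * s * ((x : ℂ) + t) ^ (-s - 1)
      + ((t : ℂ) ^ 3 - 3 / 2 * t ^ 2 + t / 2) / 6 * (s * (s + 1)) * ((x : ℂ) + t) ^ (-s - 2))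
      + ((x : ℂ) + t) ^ (1 - s)
  have hΦ : ∀ t ∈ Icc (0 : ℝ) 1, HasDerivWithinAt Φ
      ((s - 1) * (((t : ℂ) ^ 3 - 3 / 2 * t ^ 2 + t / 2) / 6 * (-(s * (s + 1) * (s + 2)))
        * ((x : ℂ) + t) ^ (-s - 3))) (Icc (0 : ℝ) 1) t := by
    intro t ht
    have hp : 0 < x + t := by linarith [ht.1]
    have hid : HasDerivAt (fun t : ℝ => (t : ℂ)) 1 t := Complex.ofRealCLM.hasDerivAt
    have e0 := hasDerivAt_add_ofReal_cpow hp (-s)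
    have e1 := hasDerivAt_add_ofReal_cpow hp (-s - 1)
    have e2 := hasDerivAt_add_ofReal_cpow hp (-s - 2)
    have e3 := hasDerivAt_add_ofReal_cpow hp (1 - s)
    have a0 := hid.sub_const (1 / 2)
    have a1 := (((((hid.pow 2).sub hid).add_const (1 / 6)).div_const 2).mul_const s)
    have a2 := ((((hid.pow 3).sub ((hid.pow 2).const_mul (3 / 2))).add (hid.div_const 2)).div_const
      6).mul_const (s * (s + 1))
    have := ((((a0.mul e0).add (a1.mul e1)).add (a2.mul e2)).const_mul (s - 1)).add e3
    refine (this.congr_deriv ?_).hasDerivWithinAt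
    rw [show -s - 1 - 1 = -s - 2 by ring, show -s - 2 - 1 = -s - 3 by ring,
      show 1 - s - 1 = -s by ring]
    simp only [Pi.pow_apply, Pi.sub_apply, Pi.add_apply]
    push_cast
    ring
  have key := norm_image_sub_le_of_norm_deriv_le_segment_01' hΦ
    (C := ‖s - 1‖ * (‖s‖ * ‖s + 1‖ * ‖s + 2‖) * x ^ (-s.re - 3)) ?_
  · refine (congrArg norm ?_).trans_le key
    simp only [Φ, Complex.ofReal_one, Complex.ofReal_zero, add_zero]
    ring
  · intro t ht
    have hp : 0 < x + t := by linarith [ht.1]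
    have hb : ‖(((t : ℂ) ^ 3 - 3 / 2 * t ^ 2 + t / 2) / 6)‖ ≤ 1 := by
      rw [show (((t : ℂ) ^ 3 - 3 / 2 * t ^ 2 + t / 2) / 6)
        = (((t ^ 3 - 3 / 2 * t ^ 2 + t / 2) / 6 : ℝ) : ℂ) by push_cast; ring,
        Complex.norm_real, Real.norm_eq_abs, abs_le]
      have h0 := ht.1
      have h1 := ht.2.le
      have h2 : t ^ 2 ≤ 1 := pow_le_one₀ h0 h1
      have h3 : t ^ 3 ≤ 1 := pow_le_one₀ h0 h1
      have h4 : 0 ≤ t ^ 2 := by positivity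
      have h5 : 0 ≤ t ^ 3 := by positivity
      constructor <;> linarith
    have hc : ‖((x : ℂ) + t) ^ (-s - 3)‖ ≤ x ^ (-s.re - 3) := by
      rw [← Complex.ofReal_add, Complex.norm_cpow_eq_rpow_re_of_pos hp]
      have : (-s - 3).re = -s.re - 3 := by simp
      rw [this]
      exact Real.rpow_le_rpow_of_nonpos hx (by linarith [ht.1]) (by linarith)
    rw [norm_mul, norm_mul, norm_mul, norm_neg, norm_mul, norm_mul, mul_assoc ‖s - 1‖]
    refine mul_le_mul_of_nonneg_left (mul_le_mul ?_ hc (norm_nonneg _) (by positivity))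
      (norm_nonneg _)
    exact mul_le_of_le_one_left (by positivity) hb

/-- Euler–Maclaurin approximations of `(s - 1) ζ(s)`. -/
noncomputable def zetaApprox (n : ℕ) (s : ℂ) : ℂ :=
  (s - 1) * (∑ k ∈ Finset.range (n + 1), ((k : ℂ) + 1) ^ (-s) - ((n : ℂ) + 1) ^ (-s) / 2
    + s / 12 * ((n : ℂ) + 1) ^ (-s - 1)) + ((n : ℂ) + 1) ^ (1 - s)

theorem norm_zetaApprox_succ_sub_le (n : ℕ) {s : ℂ} (hs : -3 ≤ s.re) :
    ‖zetaApprox (n + 1) s - zetaApprox n s‖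
      ≤ ‖s - 1‖ * (‖s‖ * ‖s + 1‖ * ‖s + 2‖) * ((n : ℝ) + 1) ^ (-s.re - 3) := by
  have h := norm_eulerMaclaurin_cpow_le (x := (n : ℝ) + 1) (by positivity) hs
  convert h using 2
  unfold zetaApprox
  rw [Finset.sum_range_succ _ (n + 1)]
  push_cast
  ring

theorem hasDerivAt_natCast_succ_cpow (n : ℕ) {f : ℂ → ℂ} {f' s : ℂ} (hf : HasDerivAt f f' s) :
    HasDerivAt (fun s => ((n : ℂ) + 1) ^ f s)
      (((n : ℂ) + 1) ^ f s * (Real.log (n + 1) : ℂ) * f') s := by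
  have h := hf.const_cpow (c := (n : ℂ) + 1) (Or.inl (Nat.cast_add_one_ne_zero n))
  have e : Complex.log ((n : ℂ) + 1) = (Real.log (n + 1) : ℂ) := by
    rw [Complex.ofReal_log (by positivity)]; push_cast; rfl
  rwa [e] at h

theorem hasDerivAt_zetaApprox (n : ℕ) (s : ℂ) :
    HasDerivAt (zetaApprox n)
      ((∑ k ∈ Finset.range (n + 1), ((k : ℂ) + 1) ^ (-s) - ((n : ℂ) + 1) ^ (-s) / 2
        + s / 12 * ((n : ℂ) + 1) ^ (-s - 1))
      + (s - 1) * (-∑ k ∈ Finset.range (n + 1), ((k : ℂ) + 1) ^ (-s) * (Real.log (k + 1) : ℂ)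
        + ((n : ℂ) + 1) ^ (-s) * (Real.log (n + 1) : ℂ) / 2
        + (1 / 12 - s / 12 * (Real.log (n + 1) : ℂ)) * ((n : ℂ) + 1) ^ (-s - 1))
      - ((n : ℂ) + 1) ^ (1 - s) * (Real.log (n + 1) : ℂ)) s := by
  have hn : HasDerivAt (fun s : ℂ => -s) (-1) s := (hasDerivAt_id s).neg
  have h1 := HasDerivAt.fun_sum (u := Finset.range (n + 1))
    fun k _ => hasDerivAt_natCast_succ_cpow k hn
  have h2 := (hasDerivAt_natCast_succ_cpow n hn).div_const 2
  have h3 := ((hasDerivAt_id s).div_const 12).mul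
    (hasDerivAt_natCast_succ_cpow n (hn.sub_const 1))
  have h4 := hasDerivAt_natCast_succ_cpow n ((hasDerivAt_id s).const_sub 1)
  refine (((((hasDerivAt_id s).sub_const 1).mul ((h1.sub h2).add h3)).add h4).congr_deriv ?_)
  simp only [id, ← Finset.sum_mul, Pi.sub_apply, Pi.add_apply, Pi.mul_apply]
  ring

theorem differentiable_zetaApprox (n : ℕ) : Differentiable ℂ (zetaApprox n) :=
  fun s => (hasDerivAt_zetaApprox n s).differentiableAt

theorem tendsto_natCast_succ_cpow_zero {s : ℂ} (hs : s.re < 0) :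
    Tendsto (fun n : ℕ => ((n : ℂ) + 1) ^ s) atTop (𝓝 0) := by
  rw [tendsto_zero_iff_norm_tendsto_zero]
  have h := ((tendsto_rpow_neg_atTop (neg_pos.2 hs)).comp tendsto_natCast_atTop_atTop).comp
    (tendsto_add_atTop_nat 1)
  refine h.congr fun n => ?_
  have : ((n : ℂ) + 1) = (((n : ℝ) + 1 : ℝ) : ℂ) := by push_cast; rfl
  rw [this, Complex.norm_cpow_eq_rpow_re_of_pos (by positivity)]
  simp

theorem tendsto_zetaApprox_of_one_lt_re {s : ℂ} (hs : 1 < s.re) :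
    Tendsto (fun n => zetaApprox n s) atTop (𝓝 ((s - 1) * riemannZeta s)) := by
  have hsum : Summable fun n : ℕ => 1 / ((n : ℂ) + 1) ^ s := by
    have := (summable_nat_add_iff 1).2 (Complex.summable_one_div_nat_cpow.2 hs)
    simpa using this
  have h1 := (hsum.hasSum.tendsto_sum_nat).comp (tendsto_add_atTop_nat 1)
  rw [← zeta_eq_tsum_one_div_nat_add_one_cpow hs] at h1
  have h2 := (tendsto_natCast_succ_cpow_zero (s := -s) (by simp; linarith)).div_const 2
  have h3 := (tendsto_natCast_succ_cpow_zero (s := -s - 1) (by simp; linarith)).const_mul (s / 12)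
  have h4 := tendsto_natCast_succ_cpow_zero (s := 1 - s) (by simp; linarith)
  have := (((h1.sub h2).add h3).const_mul (s - 1)).add h4
  simp only [zero_div, mul_zero, sub_zero, add_zero] at this
  refine this.congr fun n => ?_
  simp only [zetaApprox, Function.comp, one_div, Complex.cpow_neg]

/-- The entire function `(s - 1) ζ(s)`. -/
noncomputable def subOneMulZeta : ℂ → ℂ :=
  Function.update (fun s => (s - 1) * riemannZeta s) 1 1

theorem differentiable_subOneMulZeta : Differentiable ℂ subOneMulZeta := by
  rw [← differentiableOn_univ,
    ← Complex.differentiableOn_compl_singleton_and_continuousAt_iff (c := 1) univ_mem]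
  constructor
  · intro s hs
    have hs1 : s ≠ 1 := hs.2
    have h : DifferentiableAt ℂ (fun s => (s - 1) * riemannZeta s) s :=
      (differentiableAt_id.sub_const 1).mul (differentiableAt_riemannZeta hs1)
    refine (h.congr_of_eventuallyEq ?_).differentiableWithinAt
    filter_upwards [isOpen_ne.mem_nhds hs1] with z hz
    simp [subOneMulZeta, Function.update_of_ne hz]
  · exact continuousAt_update_same.2 riemannZeta_residue_one

/-- The increments of `zetaApprox` are holomorphic and uniformly summable near `-1`. Their sum is
identified with `(s - 1) ζ(s)` for `Re s > 1`, then continued by the identity theorem and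
differentiated termwise. -/
theorem tendsto_deriv_zetaApprox_neg_one :
    Tendsto (fun n => deriv (zetaApprox n) (-1)) atTop
      (𝓝 (riemannZeta (-1) - 2 * deriv riemannZeta (-1))) := by
  -- The half-plane makes the exponent `-Re s - 3` less than `-3/2`, hence summable; the ball bounds
  -- the polynomial factor in `s`. Both `-1` and `2` lie in this convex set.
  let U : Set ℂ := {s | -(3 / 2 : ℝ) < s.re} ∩ Metric.ball 0 10
  have hU : IsOpen U := (isOpen_lt continuous_const Complex.continuous_re).inter Metric.isOpen_ball
  have hconv : Convex ℝ U := (convex_halfSpace_re_gt _).inter (convex_ball _ _)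
  let D : ℕ → ℂ → ℂ := fun n s => zetaApprox (n + 1) s - zetaApprox n s
  let u : ℕ → ℝ := fun n => 11 * (10 * 11 * 12) * ((n : ℝ) + 1) ^ (-(3 / 2) : ℝ)
  have hu : Summable u := by
    refine Summable.mul_left _ ?_
    have := (summable_nat_add_iff 1).2 (Real.summable_nat_rpow.2 (by norm_num : -(3 / 2 : ℝ) < -1))
    simpa using this
  have hD : ∀ n, DifferentiableOn ℂ (D n) U := fun n =>
    ((differentiable_zetaApprox (n + 1)).sub (differentiable_zetaApprox n)).differentiableOn
  have hle : ∀ n s, s ∈ U → ‖D n s‖ ≤ u n := by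
    rintro n s ⟨hs, hs'⟩
    have hs : -(3 / 2 : ℝ) < s.re := hs
    have hn : ‖s‖ ≤ 10 := by simpa using (mem_ball_zero_iff.1 hs').le
    refine (norm_zetaApprox_succ_sub_le n (by linarith)).trans ?_
    have b1 : ‖s - 1‖ ≤ 11 := (norm_sub_le _ _).trans (by norm_num; linarith)
    have b2 : ‖s + 1‖ ≤ 11 := (norm_add_le _ _).trans (by norm_num; linarith)
    have b3 : ‖s + 2‖ ≤ 12 := (norm_add_le _ _).trans (by norm_num; linarith)
    have b4 : ((n : ℝ) + 1) ^ (-s.re - 3) ≤ ((n : ℝ) + 1) ^ (-(3 / 2) : ℝ) :=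
      Real.rpow_le_rpow_of_exponent_le (by linarith [n.cast_nonneg (α := ℝ)]) (by linarith)
    simp only [u]
    gcongr
  have htel : ∀ s n, ∑ i ∈ Finset.range n, D i s = zetaApprox n s - zetaApprox 0 s :=
    fun s n => Finset.sum_range_sub (fun i => zetaApprox i s) n
  let T : ℂ → ℂ := fun s => ∑' n, D n s
  have hT : DifferentiableOn ℂ T U := Complex.differentiableOn_tsum_of_summable_norm hu hD hU hle
  have hEq : EqOn T (fun s => subOneMulZeta s - zetaApprox 0 s) U := by
    refine AnalyticOnNhd.eqOn_of_preconnected_of_eventuallyEq (z₀ := 2) (hT.analyticOnNhd hU)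
      ((differentiable_subOneMulZeta.sub
        (differentiable_zetaApprox 0)).differentiableOn.analyticOnNhd hU)
      hconv.isPreconnected ?_ ?_
    · constructor
      · simp only [mem_ofPred_eq]; norm_num
      · simp only [Metric.mem_ball, dist_zero_right]; norm_num
    · have h2 : (2 : ℂ) ∈ U := by
        constructor
        · simp only [mem_ofPred_eq]; norm_num
        · simp only [Metric.mem_ball, dist_zero_right]; norm_num
      filter_upwards [hU.mem_nhds h2,
        (isOpen_lt continuous_const Complex.continuous_re).mem_nhds
          (show (2 : ℂ) ∈ {s : ℂ | 1 < s.re} by simp)] with s hs hs1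
      have hs1 : 1 < s.re := hs1
      have hsum : Summable fun n => D n s := Summable.of_norm_bounded hu fun n => hle n s hs
      have t1 := hsum.hasSum.tendsto_sum_nat
      simp only [htel] at t1
      have t2 := (tendsto_zetaApprox_of_one_lt_re hs1).sub_const (zetaApprox 0 s)
      have hne : s ≠ 1 := by rintro rfl; simp at hs1
      simp only [T, subOneMulZeta, Function.update_of_ne hne]
      exact tendsto_nhds_unique t1 t2
  have hm : (-1 : ℂ) ∈ U := by
    constructor
    · simp only [mem_ofPred_eq]; norm_num
    · simp only [Metric.mem_ball, dist_zero_right]; norm_num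
  have hder := (Complex.hasSum_deriv_of_summable_norm hu hD hU hle hm).tendsto_sum_nat
  have hTd : deriv T (-1) = deriv subOneMulZeta (-1) - deriv (zetaApprox 0) (-1) := by
    rw [(hEq.eventuallyEq_of_mem (hU.mem_nhds hm)).deriv_eq]
    exact deriv_fun_sub (differentiable_subOneMulZeta _) (differentiable_zetaApprox 0 _)
  have hZ : deriv subOneMulZeta (-1) = riemannZeta (-1) - 2 * deriv riemannZeta (-1) := by
    have hne : (-1 : ℂ) ≠ 1 := by norm_num
    have : subOneMulZeta =ᶠ[𝓝 (-1)] fun s => (s - 1) * riemannZeta s := by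
      filter_upwards [isOpen_ne.mem_nhds hne] with z hz
      simp [subOneMulZeta, Function.update_of_ne hz]
    rw [this.deriv_eq]
    have h := ((hasDerivAt_id (-1 : ℂ)).sub_const 1).mul
      (differentiableAt_riemannZeta hne).hasDerivAt
    refine (h.congr_deriv ?_).deriv
    simp only [id]
    ring
  have hs : ∀ n, ∑ i ∈ Finset.range n, deriv (D i) (-1)
      = deriv (zetaApprox n) (-1) - deriv (zetaApprox 0) (-1) := by
    intro n
    rw [← Finset.sum_range_sub (fun i => deriv (zetaApprox i) (-1)) n]
    refine Finset.sum_congr rfl fun i _ => ?_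
    exact deriv_fun_sub (differentiable_zetaApprox _ _) (differentiable_zetaApprox _ _)
  have hlim : Tendsto (fun n => ∑ i ∈ Finset.range n, deriv (D i) (-1)) atTop
      (𝓝 (deriv T (-1))) := hder
  simp only [hs, hTd, hZ] at hlim
  simpa using hlim.add_const (deriv (zetaApprox 0) (-1))

/-! ### The Glaisher sequence and Kinkelin's formula -/

theorem log_glaisherSeq_succ (n : ℕ) :
    Real.log (glaisherSeq (n + 1)) = ∑ k ∈ Finset.range (n + 1), ((k : ℝ) + 1) * Real.log (k + 1)
      - (((n : ℝ) + 1) ^ 2 / 2 + ((n : ℝ) + 1) / 2 + 1 / 12) * Real.log (n + 1)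
      + ((n : ℝ) + 1) ^ 2 / 4 := by
  have hpos : (0 : ℝ) < (n : ℝ) + 1 := by positivity
  have hprod : ∏ k ∈ Finset.Icc 1 (n + 1), (k : ℝ) ^ k
      = ∏ k ∈ Finset.range (n + 1), ((k : ℝ) + 1) ^ (k + 1) := by
    clear hpos
    induction n with
    | zero => simp
    | succ n ih =>
      rw [Finset.prod_Icc_succ_top (by lia), ih, Finset.prod_range_succ _ (n + 1)]
      push_cast
      rfl
  unfold glaisherSeq
  rw [hprod, Real.log_div (Finset.prod_ne_zero_iff.2 fun k _ => by positivity) (by positivity),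
    Real.log_mul (by positivity) (by positivity), Real.log_exp,
    Real.log_prod (fun k _ => by positivity)]
  push_cast
  rw [Real.log_rpow hpos]
  simp only [Real.log_pow]
  push_cast
  ring

theorem glaisherSeq_succ_pos (n : ℕ) : 0 < glaisherSeq (n + 1) := by
  unfold glaisherSeq
  refine div_pos (Finset.prod_pos fun k hk => ?_) (by positivity)
  have : 0 < k := (Finset.mem_Icc.1 hk).1
  positivity

theorem deriv_zetaApprox_neg_one (n : ℕ) :
    deriv (zetaApprox n) (-1) = ((2 * Real.log (glaisherSeq (n + 1)) - 1 / 4 : ℝ) : ℂ) := by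
  have hs : ∑ k ∈ Finset.range (n + 1), ((k : ℂ) + 1) = ((n : ℂ) + 1) * ((n : ℂ) + 2) / 2 := by
    induction n with
    | zero => simp
    | succ n ih => rw [Finset.sum_range_succ, ih]; push_cast; ring
  rw [(hasDerivAt_zetaApprox n (-1)).deriv, log_glaisherSeq_succ]
  have e1 : (1 - (-1) : ℂ) = (2 : ℕ) := by norm_num
  have e2 : (-(-1) - 1 : ℂ) = 0 := by norm_num
  rw [e1, e2]
  simp only [neg_neg, Complex.cpow_one, Complex.cpow_zero, Complex.cpow_natCast, hs]
  push_cast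
  ring

theorem riemannZeta_neg_one : riemannZeta (-1) = -1 / 12 := by
  have h := riemannZeta_neg_nat_eq_bernoulli' 1
  rw [bernoulli'_two] at h
  push_cast at h
  rw [h]
  norm_num

theorem tendsto_log_glaisherSeq :
    Tendsto (fun n => Real.log (glaisherSeq n)) atTop
      (𝓝 (1 / 12 - (deriv riemannZeta (-1)).re)) := by
  rw [← tendsto_add_atTop_iff_nat 1]
  have h := (Complex.continuous_re.tendsto _).comp tendsto_deriv_zetaApprox_neg_one
  have h' := (h.add_const (1 / 4)).div_const 2
  rw [riemannZeta_neg_one] at h'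
  convert h' using 1
  · funext n
    simp only [Function.comp, deriv_zetaApprox_neg_one, Complex.ofReal_re]
    ring
  · congr 1
    simp
    ring

/-- The approximating derivatives are real, so their limit is. -/
theorem im_deriv_riemannZeta_neg_one : (deriv riemannZeta (-1)).im = 0 := by
  have h := (Complex.continuous_im.tendsto _).comp tendsto_deriv_zetaApprox_neg_one
  have h0 : (Complex.im ∘ fun n => deriv (zetaApprox n) (-1)) = fun _ => 0 := by
    funext n
    simp only [Function.comp, deriv_zetaApprox_neg_one, Complex.ofReal_im]
  rw [h0] at h
  have := tendsto_nhds_unique h tendsto_const_nhds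
  rw [riemannZeta_neg_one] at this
  simpa using this

theorem tendsto_glaisherSeq :
    Tendsto glaisherSeq atTop (𝓝 (Real.exp (1 / 12 - (deriv riemannZeta (-1)).re))) := by
  refine (((Real.continuous_exp.tendsto _).comp tendsto_log_glaisherSeq)).congr' ?_
  filter_upwards [eventually_ge_atTop 1] with n hn
  obtain ⟨m, rfl⟩ := Nat.exists_eq_add_of_le' hn
  exact Real.exp_log (glaisherSeq_succ_pos m)

theorem glaisherKinkelin_eq :
    glaisherKinkelin = Real.exp (1 / 12 - (deriv riemannZeta (-1)).re) :=
  tendsto_glaisherSeq.limUnder_eq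

/-- Kinkelin's formula `ζ'(-1) = 1/12 - log A`. -/
theorem deriv_riemannZeta_neg_one :
    deriv riemannZeta (-1) = ((1 / 12 - Real.log glaisherKinkelin : ℝ) : ℂ) := by
  rw [glaisherKinkelin_eq, Real.log_exp]
  apply Complex.ext
  · simp
  · rw [im_deriv_riemannZeta_neg_one, Complex.ofReal_im]

/-! ### The functional equation differentiated at `s = 2` -/

theorem hasDerivAt_Gamma_two :
    HasDerivAt Complex.Gamma (1 - (Real.eulerMascheroniConstant : ℂ)) 2 := by
  have h := Complex.hasDerivAt_Gamma_nat 1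
  have e : ((1 : ℕ) : ℂ) + 1 = 2 := by norm_num
  rw [e] at h
  refine h.congr_deriv ?_
  simp [harmonic]
  ring

theorem Gamma_two : Complex.Gamma 2 = 1 := by simp

/-- Logarithmic differentiation of the functional equation; the cosine factor contributes nothing
because `sin π = 0`. -/
theorem deriv_riemannZeta_neg_one_eq_deriv_two :
    deriv riemannZeta (-1) = (1 / 12) * (1 - (Real.eulerMascheroniConstant : ℂ)
      - (Real.log (2 * Real.pi) : ℂ) + 6 / (Real.pi : ℂ) ^ 2 * deriv riemannZeta 2) := by
  have hpi : (Real.pi : ℂ) ≠ 0 := Complex.ofReal_ne_zero.2 Real.pi_ne_zero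
  have hev : (fun s : ℂ => riemannZeta (1 - s)) =ᶠ[𝓝 2] fun s =>
      2 * (2 * (Real.pi : ℂ)) ^ (-s) * Complex.Gamma s * Complex.cos (Real.pi * s / 2)
        * riemannZeta s := by
    filter_upwards [(isOpen_lt continuous_const Complex.continuous_re).mem_nhds
          (show (2 : ℂ) ∈ {s : ℂ | 1 < s.re} by simp)] with s hs
    have hs : 1 < s.re := hs
    refine riemannZeta_one_sub (fun n h => ?_) (fun h => ?_)
    · rw [h] at hs
      simp at hs
      linarith [n.cast_nonneg (α := ℝ)]
    · rw [h] at hs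
      simp at hs
  have hl : HasDerivAt (fun s : ℂ => riemannZeta (1 - s)) (deriv riemannZeta (-1) * (-1)) 2 := by
    have e : (1 : ℂ) - 2 = -1 := by norm_num
    have h : HasDerivAt riemannZeta (deriv riemannZeta (-1)) (1 - 2) := by
      rw [e]; exact (differentiableAt_riemannZeta (by norm_num)).hasDerivAt
    exact h.comp (2 : ℂ) ((hasDerivAt_id (2 : ℂ)).const_sub 1)
  have h1 : HasDerivAt (fun s : ℂ => (2 * (Real.pi : ℂ)) ^ (-s))
      ((2 * (Real.pi : ℂ)) ^ (-2 : ℂ) * Complex.log (2 * Real.pi) * (-1)) 2 :=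
    ((hasDerivAt_id (2 : ℂ)).neg).const_cpow (Or.inl (by simp))
  have h3 : HasDerivAt (fun s : ℂ => Complex.cos (Real.pi * s / 2))
      (-Complex.sin (Real.pi * 2 / 2) * (Real.pi * 1 / 2)) 2 :=
    (((hasDerivAt_id (2 : ℂ)).const_mul (Real.pi : ℂ)).div_const 2).ccos
  have h4 : HasDerivAt riemannZeta (deriv riemannZeta 2) 2 :=
    (differentiableAt_riemannZeta (by norm_num)).hasDerivAt
  have hr := (((h1.const_mul 2).mul hasDerivAt_Gamma_two).mul h3).mul h4
  have := hl.unique (hr.congr_of_eventuallyEq hev)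
  have elog : Complex.log (2 * Real.pi) = (Real.log (2 * Real.pi) : ℂ) := by
    rw [Complex.ofReal_log (by positivity)]; push_cast; rfl
  have ec : (Real.pi * 2 / 2 : ℂ) = Real.pi := by ring
  have ep : (2 * (Real.pi : ℂ)) ^ (-2 : ℂ) = 1 / (4 * (Real.pi : ℂ) ^ 2) := by
    rw [Complex.cpow_neg, show (2 : ℂ) = ((2 : ℕ) : ℂ) by norm_num, Complex.cpow_natCast]
    push_cast
    rw [mul_pow]; norm_num
  simp only [Pi.mul_apply] at this
  rw [elog, ec, ep, Gamma_two, riemannZeta_two, Complex.cos_pi, Complex.sin_pi] at this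
  have h5 : deriv riemannZeta (-1) = -(deriv riemannZeta (-1) * (-1)) := by ring
  rw [h5, this]
  field_simp
  ring

/-! ### Mellin transform of `1 / sinh` -/

theorem hasSum_inv_sinh {t : ℝ} (ht : 0 < t) :
    HasSum (fun n : ℕ => 2 * Real.exp (-(2 * n + 1) * t)) (Real.sinh t)⁻¹ := by
  have hlt : Real.exp (-2 * t) < 1 := Real.exp_zero ▸ Real.exp_lt_exp.2 (by linarith)
  have h := (hasSum_geometric_of_lt_one (Real.exp_pos _).le hlt).mul_left (2 * Real.exp (-t))
  convert! h using 1
  · funext n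
    rw [← Real.exp_nat_mul, mul_assoc, ← Real.exp_add]
    congr 2
    ring
  · have hs : 0 < Real.sinh t := Real.sinh_pos_iff.2 ht
    have : 1 - Real.exp (-2 * t) = 2 * Real.exp (-t) * Real.sinh t := by
      rw [Real.sinh_eq]
      have e1 : Real.exp (-t) * Real.exp t = 1 := by rw [← Real.exp_add]; simp
      have e2 : Real.exp (-2 * t) = Real.exp (-t) * Real.exp (-t) := by
        rw [← Real.exp_add]; congr 1; ring
      rw [e2]
      linear_combination -e1
    rw [this]
    have := Real.exp_pos (-t)
    field_simp

theorem hasSum_odd_cpow {s : ℂ} (hs : 1 < s.re) :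
    HasSum (fun n : ℕ => 1 / ((2 * n + 1 : ℕ) : ℂ) ^ s)
      ((1 - (2 : ℂ) ^ (-s)) * riemannZeta s) := by
  have hsum : Summable fun n : ℕ => 1 / (n : ℂ) ^ s := Complex.summable_one_div_nat_cpow.2 hs
  have hz := zeta_eq_tsum_one_div_nat_cpow hs
  have he : HasSum (fun n : ℕ => 1 / ((2 * n : ℕ) : ℂ) ^ s) ((2 : ℂ) ^ (-s) * riemannZeta s) := by
    rw [hz]
    convert! hsum.hasSum.mul_left ((2 : ℂ) ^ (-s)) using 2 with n
    rw [Nat.cast_mul, Complex.natCast_mul_natCast_cpow, Complex.cpow_neg]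
    push_cast
    field_simp
  have ho : Summable fun n : ℕ => 1 / ((2 * n + 1 : ℕ) : ℂ) ^ s :=
    hsum.comp_injective (i := fun n : ℕ => 2 * n + 1) (fun a b h => by simpa using h)
  have h := HasSum.even_add_odd (f := fun n : ℕ => 1 / (n : ℂ) ^ s) he ho.hasSum
  have h2 := h.unique hsum.hasSum
  rw [← hz] at h2
  convert! ho.hasSum using 1
  linear_combination -h2

/-- Termwise integration of the series in `exp (-(2n + 1) t)` leaves the sum over odd integers of
`n^(-s)`. -/
theorem mellin_inv_sinh {s : ℂ} (hs : 1 < s.re) :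
    mellin (fun t : ℝ => ((Real.sinh t)⁻¹ : ℂ)) s
      = 2 * Complex.Gamma s * ((1 - (2 : ℂ) ^ (-s)) * riemannZeta s) := by
  have h := hasSum_mellin (a := fun _ : ℕ => (2 : ℂ)) (p := fun n : ℕ => (2 * n + 1 : ℝ))
    (F := fun t : ℝ => ((Real.sinh t)⁻¹ : ℂ)) (s := s) (fun n => Or.inr (by positivity))
    (by linarith) ?_ ?_
  · refine h.unique ?_
    convert! (hasSum_odd_cpow hs).mul_left (2 * Complex.Gamma s) using 2 with n
    push_cast
    ring
  · intro t ht
    have := Complex.hasSum_ofReal.2 (hasSum_inv_sinh ht)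
    simpa only [Complex.ofReal_mul, Complex.ofReal_ofNat, Complex.ofReal_inv] using this
  · have hsum : Summable fun n : ℕ => 1 / (n : ℝ) ^ s.re := Real.summable_one_div_nat_rpow.2 hs
    have ho := (hsum.comp_injective (i := fun n : ℕ => 2 * n + 1)
      (fun a b h => by simpa using h)).mul_left 2
    refine ho.congr fun n => ?_
    simp [div_eq_mul_inv]

theorem inv_sinh_le_inv {t : ℝ} (ht : 0 < t) : (Real.sinh t)⁻¹ ≤ t⁻¹ :=
  inv_anti₀ ht (Real.self_le_sinh_iff.2 ht.le)

/-- Exponent `-3` here and `-1` at zero put `s = 2` inside the strip `1 < Re s < 3`, where the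
Mellin transform may be differentiated. -/
theorem inv_sinh_isBigO_atTop :
    (fun t : ℝ => ((Real.sinh t)⁻¹ : ℂ)) =O[atTop] fun t : ℝ => t ^ (-3 : ℝ) := by
  have h1 : (fun t : ℝ => ((Real.sinh t)⁻¹ : ℂ)) =O[atTop] fun t : ℝ => Real.exp (-1 * t) := by
    refine Asymptotics.IsBigO.of_bound 4 ?_
    filter_upwards [eventually_ge_atTop 1] with t ht
    rw [norm_inv, Complex.norm_real, Real.norm_eq_abs, Real.norm_eq_abs,
      abs_of_pos (Real.exp_pos _), abs_of_pos (Real.sinh_pos_iff.2 (by linarith))]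
    have e1 : Real.exp (-1 * t) * Real.exp t = 1 := by rw [← Real.exp_add]; simp
    have e2 : Real.exp (-1 * t) ≤ 1 := Real.exp_le_one_iff.2 (by linarith)
    have e3 : 2 ≤ Real.exp t := by linarith [Real.add_one_le_exp t]
    have e4 : 0 < Real.exp (-1 * t) := Real.exp_pos _
    rw [inv_le_iff_one_le_mul₀ (Real.sinh_pos_iff.2 (by linarith)), Real.sinh_eq,
      show -t = -1 * t by ring]
    nlinarith
  exact h1.trans (isLittleO_exp_neg_mul_rpow_atTop one_pos _).isBigO

theorem inv_sinh_isBigO_zero :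
    (fun t : ℝ => ((Real.sinh t)⁻¹ : ℂ)) =O[𝓝[>] 0] fun t : ℝ => t ^ (-1 : ℝ) := by
  refine Asymptotics.IsBigO.of_bound 1 ?_
  filter_upwards [self_mem_nhdsWithin] with t ht
  have ht : 0 < t := ht
  rw [norm_inv, Complex.norm_real, Real.norm_eq_abs, Real.norm_eq_abs, Real.rpow_neg_one,
    abs_of_pos (inv_pos.2 ht), abs_of_pos (Real.sinh_pos_iff.2 ht), one_mul]
  exact inv_sinh_le_inv ht

theorem locallyIntegrableOn_inv_sinh :
    LocallyIntegrableOn (fun t : ℝ => ((Real.sinh t)⁻¹ : ℂ)) (Ioi 0) := by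
  refine ContinuousOn.locallyIntegrableOn ?_ measurableSet_Ioi
  refine ContinuousOn.inv₀ (by fun_prop) fun t ht => ?_
  exact Complex.ofReal_ne_zero.2 (Real.sinh_pos_iff.2 ht).ne'

theorem mellinConvergent_inv_sinh :
    MellinConvergent (fun t : ℝ => ((Real.sinh t)⁻¹ : ℂ)) 2 :=
  mellinConvergent_of_isBigO_rpow locallyIntegrableOn_inv_sinh inv_sinh_isBigO_atTop
    (by norm_num) inv_sinh_isBigO_zero (by norm_num)

theorem integrableOn_div_sinh : IntegrableOn (fun t : ℝ => ((t / Real.sinh t : ℝ) : ℂ)) (Ioi 0) := by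
  refine mellinConvergent_inv_sinh.congr_fun (fun t _ => ?_) measurableSet_Ioi
  beta_reduce
  rw [show (2 : ℂ) - 1 = 1 by norm_num, Complex.cpow_one, smul_eq_mul]
  push_cast
  rfl

theorem integral_div_sinh :
    ∫ t in Ioi (0 : ℝ), ((t / Real.sinh t : ℝ) : ℂ) = (Real.pi : ℂ) ^ 2 / 4 := by
  have h := mellin_inv_sinh (s := 2) (by norm_num)
  rw [Gamma_two, riemannZeta_two, Complex.cpow_neg,
    show (2 : ℂ) ^ (2 : ℂ) = 4 by
      rw [show (2 : ℂ) ^ (2 : ℂ) = (2 : ℂ) ^ ((2 : ℕ) : ℂ) by norm_num, Complex.cpow_natCast]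
      norm_num] at h
  rw [show (Real.pi : ℂ) ^ 2 / 4 = 2 * 1 * ((1 - (4 : ℂ)⁻¹) * ((Real.pi : ℂ) ^ 2 / 6)) by ring, ← h]
  refine setIntegral_congr_fun measurableSet_Ioi fun t _ => ?_
  rw [show (2 : ℂ) - 1 = 1 by norm_num, Complex.cpow_one, smul_eq_mul]
  push_cast
  rfl

theorem integrableOn_mul_log_div_sinh :
    IntegrableOn (fun t : ℝ => ((t * Real.log t / Real.sinh t : ℝ) : ℂ)) (Ioi 0) := by
  refine (mellin_hasDerivAt_of_isBigO_rpow locallyIntegrableOn_inv_sinh inv_sinh_isBigO_atTop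
    (s := 2) (by norm_num) inv_sinh_isBigO_zero (by norm_num)).1.congr_fun (fun t _ => ?_)
    measurableSet_Ioi
  beta_reduce
  rw [show (2 : ℂ) - 1 = 1 by norm_num, Complex.cpow_one, smul_eq_mul, Complex.real_smul]
  push_cast
  ring

theorem integral_mul_log_div_sinh :
    ∫ t in Ioi (0 : ℝ), ((t * Real.log t / Real.sinh t : ℝ) : ℂ)
      = (Real.pi : ℂ) ^ 2 / 4 * (1 - (Real.eulerMascheroniConstant : ℂ) + (Real.log 2 : ℂ) / 3
        + 6 / (Real.pi : ℂ) ^ 2 * deriv riemannZeta 2) := by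
  have hpi : (Real.pi : ℂ) ≠ 0 := Complex.ofReal_ne_zero.2 Real.pi_ne_zero
  have h := (mellin_hasDerivAt_of_isBigO_rpow locallyIntegrableOn_inv_sinh inv_sinh_isBigO_atTop
    (s := 2) (by norm_num) inv_sinh_isBigO_zero (by norm_num)).2
  have hev : mellin (fun t : ℝ => ((Real.sinh t)⁻¹ : ℂ)) =ᶠ[𝓝 2] fun s =>
      2 * Complex.Gamma s * ((1 - (2 : ℂ) ^ (-s)) * riemannZeta s) := by
    filter_upwards [(isOpen_lt continuous_const Complex.continuous_re).mem_nhds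
          (show (2 : ℂ) ∈ {s : ℂ | 1 < s.re} by simp)] with s hs
    exact mellin_inv_sinh hs
  have h1 : HasDerivAt (fun s : ℂ => 1 - (2 : ℂ) ^ (-s))
      (-((2 : ℂ) ^ (-2 : ℂ) * Complex.log 2 * (-1))) 2 :=
    (((hasDerivAt_id (2 : ℂ)).neg).const_cpow (Or.inl two_ne_zero)).const_sub 1
  have h4 : HasDerivAt riemannZeta (deriv riemannZeta 2) 2 :=
    (differentiableAt_riemannZeta (by norm_num)).hasDerivAt
  have hr := (hasDerivAt_Gamma_two.const_mul 2).mul (h1.mul h4)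
  have key := h.unique (hr.congr_of_eventuallyEq hev)
  have elog : Complex.log 2 = (Real.log 2 : ℂ) := by
    rw [Complex.ofReal_log (by positivity)]; push_cast; rfl
  have ep : (2 : ℂ) ^ (-2 : ℂ) = 1 / 4 := by
    rw [Complex.cpow_neg, show (2 : ℂ) ^ (2 : ℂ) = (2 : ℂ) ^ ((2 : ℕ) : ℂ) by norm_num,
      Complex.cpow_natCast]
    norm_num
  simp only [Pi.mul_apply] at key
  rw [ep, elog, Gamma_two, riemannZeta_two] at key
  have hint : ∫ t in Ioi (0 : ℝ), ((t * Real.log t / Real.sinh t : ℝ) : ℂ)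
      = mellin (fun t : ℝ => Real.log t • ((Real.sinh t)⁻¹ : ℂ)) 2 := by
    refine setIntegral_congr_fun measurableSet_Ioi fun t _ => ?_
    simp only
    rw [show (2 : ℂ) - 1 = 1 by norm_num, Complex.cpow_one, smul_eq_mul, Complex.real_smul]
    push_cast
    ring
  rw [hint, key]
  field_simp
  ring

/-! ### Change of variables and evaluation -/

theorem abs_deriv_smul_nestedLogIntegrand_exp (t : ℝ) :
    |Real.exp (t / 2) * (1 / 2)| • nestedLogIntegrand (Real.exp (t / 2))
      = (t : ℂ) * Complex.log t / (8 * (Real.sinh t : ℂ)) := by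
  rcases eq_or_ne t 0 with rfl | ht
  -- At `t = 0` both sides are zero by the convention for division by zero.
  · simp [nestedLogIntegrand]
  have hs : (Real.sinh t : ℂ) ≠ 0 := Complex.ofReal_ne_zero.2 (by simpa using ht)
  have hl : Real.log (Real.exp (t / 2) ^ 2) = t := by
    rw [Real.log_pow, Real.log_exp]; push_cast; ring
  have e2 : (Real.exp (t / 2) : ℂ) ^ 2 = (Real.exp t : ℂ) := by
    rw [← Complex.ofReal_pow, ← Real.exp_nat_mul]; congr 2; push_cast; ring
  have e4 : (Real.exp (t / 2) : ℂ) ^ 4 - 1 = 2 * (Real.exp t : ℂ) * (Real.sinh t : ℂ) := by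
    have h : (Real.exp t : ℂ) * (Real.exp (-t) : ℂ) = 1 := by
      rw [← Complex.ofReal_mul, ← Real.exp_add]; simp
    rw [show (Real.exp (t / 2) : ℂ) ^ 4 = ((Real.exp (t / 2) : ℂ) ^ 2) ^ 2 by ring, e2,
      Real.sinh_eq]
    push_cast at h ⊢
    linear_combination h
  have he : (Real.exp t : ℂ) ≠ 0 := Complex.ofReal_ne_zero.2 (Real.exp_pos t).ne'
  rw [abs_of_pos (by positivity), Complex.real_smul, nestedLogIntegrand, hl, Real.log_exp, e4]
  push_cast at e2 hs he ⊢
  field_simp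
  rw [e2]
  ring

theorem integrableOn_and_integral_nestedLogIntegrand :
    IntegrableOn nestedLogIntegrand (Ioi 0) ∧
    ∫ x in Ioi (0 : ℝ), nestedLogIntegrand x
      = (1 / 8) * (2 * ∫ t in Ioi (0 : ℝ), ((t * Real.log t / Real.sinh t : ℝ) : ℂ))
        + (1 / 8) * (Complex.I * Real.pi * ∫ t in Ioi (0 : ℝ), ((t / Real.sinh t : ℝ) : ℂ)) := by
  let h : ℝ → ℂ := fun t => (t : ℂ) * Complex.log t / (8 * (Real.sinh t : ℂ))
  have himg : (fun t : ℝ => Real.exp (t / 2)) '' univ = Ioi 0 := by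
    ext x
    simp only [image_univ, mem_range, mem_Ioi]
    constructor
    · rintro ⟨t, rfl⟩; exact Real.exp_pos _
    · intro hx
      exact ⟨2 * Real.log x, by rw [mul_div_cancel_left₀ _ two_ne_zero, Real.exp_log hx]⟩
  have hder : ∀ t ∈ (univ : Set ℝ), HasDerivWithinAt (fun t : ℝ => Real.exp (t / 2))
      (Real.exp (t / 2) * (1 / 2)) univ t := fun t _ =>
    (((hasDerivAt_id t).div_const 2).exp).hasDerivWithinAt
  have hinj : InjOn (fun t : ℝ => Real.exp (t / 2)) univ := fun a _ b _ hab => by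
    have := Real.exp_injective hab
    linarith
  have hI := integrableOn_image_iff_integrableOn_abs_deriv_smul MeasurableSet.univ hder hinj
    nestedLogIntegrand
  have hE := integral_image_eq_integral_abs_deriv_smul MeasurableSet.univ hder hinj
    nestedLogIntegrand
  simp only [himg, abs_deriv_smul_nestedLogIntegrand_exp] at hI hE
  have hpos : EqOn h (fun t => (1 / 8) * ((t * Real.log t / Real.sinh t : ℝ) : ℂ)) (Ioi 0) := by
    intro t ht
    simp only [h]
    rw [← Complex.ofReal_log (le_of_lt ht)]
    push_cast
    ring
  have hneg : EqOn (fun t => h (-t)) (fun t => (1 / 8) * ((t * Real.log t / Real.sinh t : ℝ) : ℂ)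
      + (1 / 8) * (Complex.I * Real.pi * ((t / Real.sinh t : ℝ) : ℂ))) (Ioi 0) := by
    intro t ht
    have ht : 0 < t := ht
    have hlog : Complex.log ((-t : ℝ) : ℂ) = (Real.log t : ℂ) + Real.pi * Complex.I := by
      rw [Complex.log, Complex.arg_ofReal_of_neg (by linarith), Complex.norm_real, norm_neg,
        Real.norm_eq_abs, abs_of_pos ht]
    simp only [h]
    rw [hlog, Real.sinh_neg]
    push_cast
    rw [mul_neg, div_neg, neg_mul, neg_div, neg_neg]
    ring
  have i1 := integrableOn_mul_log_div_sinh.const_mul (1 / 8 : ℂ)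
  have i2 := (integrableOn_div_sinh.const_mul (Complex.I * Real.pi)).const_mul (1 / 8 : ℂ)
  have hIpos : IntegrableOn h (Ioi 0) := IntegrableOn.congr_fun i1 hpos.symm measurableSet_Ioi
  have hIneg' : IntegrableOn (fun t => h (-t)) (Ioi 0) :=
    IntegrableOn.congr_fun (i1.add i2) hneg.symm measurableSet_Ioi
  have hIneg : IntegrableOn h (Iic 0) := by
    have : IntegrableOn (fun t => h (-t)) (Ici (-0)) := by
      rw [neg_zero]
      rwa [integrableOn_Ici_iff_integrableOn_Ioi]
    simpa only [neg_neg] using this.comp_neg_Iic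
  have hall : Integrable h := by
    rw [← integrableOn_univ, ← Iic_union_Ioi (a := (0 : ℝ))]
    exact hIneg.union hIpos
  refine ⟨hI.2 hall.integrableOn, ?_⟩
  rw [hE, setIntegral_univ, ← intervalIntegral.integral_Iic_add_Ioi hIneg hIpos,
    setIntegral_congr_fun measurableSet_Ioi hpos]
  have hn : ∫ t in Iic (0 : ℝ), h t = ∫ t in Ioi (0 : ℝ), h (-t) := by
    rw [integral_comp_neg_Ioi, neg_zero]
  rw [hn, setIntegral_congr_fun measurableSet_Ioi hneg, integral_add i1 i2]
  simp only [integral_const_mul]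
  ring

theorem mainTheorem12 :
    (Tendsto glaisherSeq atTop (𝓝 glaisherKinkelin) ∧ 0 < glaisherKinkelin) ∧
    IntegrableOn nestedLogIntegrand (Ioi 0) volume ∧
    ∫ x in Ioi (0 : ℝ), nestedLogIntegrand x =
      ((Real.pi : ℂ) ^ 2 / 32) *
        (8 * (Real.log ((2 : ℝ) ^ (1 / 3 : ℝ) * Real.pi ^ (1 / 4 : ℝ) / glaisherKinkelin ^ 3) : ℂ)
          + 2 + Complex.I * (Real.pi : ℂ)) := by
  have hA : 0 < glaisherKinkelin := by rw [glaisherKinkelin_eq]; exact Real.exp_pos _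
  refine ⟨⟨?_, hA⟩, integrableOn_and_integral_nestedLogIntegrand.1, ?_⟩
  · rw [glaisherKinkelin_eq]; exact tendsto_glaisherSeq
  have hpi := Real.pi_pos
  have hz := deriv_riemannZeta_neg_one_eq_deriv_two
  rw [deriv_riemannZeta_neg_one, Real.log_mul two_ne_zero hpi.ne'] at hz
  rw [integrableOn_and_integral_nestedLogIntegrand.2, integral_mul_log_div_sinh,
    integral_div_sinh, Real.log_div (by positivity) (by positivity),
    Real.log_mul (by positivity) (by positivity), Real.log_rpow two_pos, Real.log_rpow hpi,
    Real.log_pow]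
  push_cast at hz ⊢
  -- The factor matches the coefficient `3/8` of `ζ'(2)` in the integral with `1 / (2π²)` in `hz`;
  -- `γ` cancels along with it.
  linear_combination (-(3 / 4) * (Real.pi : ℂ) ^ 2) * hz
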